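/- For a set $M$ let $W(M)$ be the set of finite words in $M$ (including the empty word $\emptyset$), let $\circ$ denote concatenation, and identify each $x\in M$ with the one-letter word $(x)$. A \emph{partial group} is a non-empty set $M$ with a subset $D\subseteq W(M)$, a map $\Pi\colon D\to M$ and an involution $x\mapsto x^{-1}$ of $M$ such that: (i) $M\subseteq D$, and $u\circ v\in D$ implies $u,v\in D$ (so $\emptyset\in D$); (ii) $\Pi(x)=x$ for all $x\in M$; (iii) if $u\circ v\circ w\in D$, then $u\circ\Pi(v)\circ w\in D$ and $\Pi(u\circ v\circ w)=\Pi(u\circ\Pi(v)\circ w)$; (iv) if $u=(x_1,\dots,x_n)\in D$ and $u^{-1}=(x_n^{-1},\dots,x_1^{-1})$, then $u^{-1}\circ u\in D$ and $\Pi(u^{-1}\circ u)=\Pi(\emptyset)$. A homomorphism from $(M_1,D_1,\Pi_1,(\cdot)^{-1})$ to $(M_2,D_2,\Pi_2,(\cdot)^{-1})$ is a map $\varphi\colon M_1\to M_2$ such that for every $u=(x_1,\dots,x_n)\in D_1$ the word $\overline\varphi(u)=(\varphi(x_1),\dots,\varphi(x_n))$ lies in $D_2$ and $\Pi_2(\overline\varphi(u))=\varphi(\Pi_1(u))$.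 Let $\mathcal{P}art$ be the category of partial groups and homomorphisms, with the usual composition of maps. Theorem A. The category $\mathcal{P}art$ is universal, that is, for every group $H$ there is a partial group $M$ with $\operatorname{Aut}_{\mathcal{P}art}(M)\cong H$. Moreover, for every group $H$ there are infinitely many pairwise non-isomorphic partial groups $M$ such that $\operatorname{Aut}_{\mathcal{P}art}(M)\cong H$. -/

import Mathlib

universe v u

open CategoryTheory

/-- A partial group on the type `M` (Chermak). Words are lists, concatenation is `++`, and an
element `x` is identified with the one-letter word `[x]`. -/
class PartialGroup (M : Type u) where
  /-- the domain `𝔻`: the set of words that can be multiplied -/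
  domain : Set (List M)
  /-- the product `Π : 𝔻 → M` -/
  prod : domain → M
  /-- the inversion -/
  inv : M → M
  nil_mem : [] ∈ domain
  singleton_mem : ∀ x : M, [x] ∈ domain
  of_append : ∀ u v : List M, u ++ v ∈ domain → u ∈ domain ∧ v ∈ domain
  prod_singleton : ∀ x : M, prod ⟨[x], singleton_mem x⟩ = x
  /-- The hypothesis `hv` follows from `h` by `of_append`; it is listed only in order to write
  down `Π(v)`. -/
  prod_subword : ∀ (u v w : List M) (hv : v ∈ domain) (h : u ++ v ++ w ∈ domain),
    ∃ h' : u ++ [prod ⟨v, hv⟩] ++ w ∈ domain,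
      prod ⟨u ++ v ++ w, h⟩ = prod ⟨u ++ [prod ⟨v, hv⟩] ++ w, h'⟩
  inv_inv : ∀ x : M, inv (inv x) = x
  /-- For `u ∈ 𝔻`, the word `u⁻¹ ∘ u` lies in `𝔻` and its product is the unit `Π(∅)`. -/
  inv_append : ∀ u ∈ domain, ∃ h : (u.map inv).reverse ++ u ∈ domain,
    prod ⟨(u.map inv).reverse ++ u, h⟩ = prod ⟨[], nil_mem⟩

/-- A homomorphism of partial groups. -/
@[ext]
structure PartialGroupHom (M N : Type u) [PartialGroup M] [PartialGroup N] where
  toFun : M → N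
  map_domain : ∀ w ∈ PartialGroup.domain (M := M),
    w.map toFun ∈ PartialGroup.domain (M := N)
  map_prod : ∀ (w : List M) (hw : w ∈ PartialGroup.domain (M := M)),
    PartialGroup.prod ⟨w.map toFun, map_domain w hw⟩ = toFun (PartialGroup.prod ⟨w, hw⟩)

namespace PartialGroupHom

/-- The identity homomorphism. -/
def id (M : Type u) [PartialGroup M] : PartialGroupHom M M where
  toFun x := x
  map_domain w hw := by simpa using hw
  map_prod w hw := by simp

/-- The composite "first `f`, then `g`". -/
def comp {M N P : Type u} [PartialGroup M] [PartialGroup N] [PartialGroup P]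
    (f : PartialGroupHom M N) (g : PartialGroupHom N P) : PartialGroupHom M P where
  toFun x := g.toFun (f.toFun x)
  map_domain w hw := by
    have h := g.map_domain _ (f.map_domain w hw)
    rw [List.map_map] at h
    exact h
  map_prod w hw := by
    have h := g.map_prod _ (f.map_domain w hw)
    rw [f.map_prod w hw] at h
    rw [← h]
    congr 2
    rw [List.map_map]
    rfl

end PartialGroupHom

/-- The objects of the category of partial groups. -/
structure PartGrp : Type (u + 1) where
  carrier : Type u
  [str : PartialGroup carrier]

attribute [instance] PartGrp.str

/-- The category of partial groups and their homomorphisms. -/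
instance PartGrp.category : Category.{u} PartGrp.{u} where
  Hom M N := PartialGroupHom M.carrier N.carrier
  id M := PartialGroupHom.id M.carrier
  comp f g := PartialGroupHom.comp f g

/-- A category is universal if every group is isomorphic to the automorphism group of one of its
objects. -/
def IsUniversalCategory (C : Type u) [Category.{v} C] : Prop :=
  ∀ (H : Type v) [Group H], ∃ X : C, Nonempty (Aut X ≃* H)

/-! A family of subsets of an abelian group gives a partial group: elements are differences inside
one member, and a word is multipliable when its partial sums trace a walk inside one member. Merging
steps skips points of the walk, and inverting reverses it. In the free abelian group on `V`, take
for each pair `(x, y)` the path `r x y` times along `x`, then once along `y`. Long repetitions force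
an injective homomorphism between two such partial groups with the same diagonal weight `N` to send
generators to generators up to sign (`eq_zero_or_single_of_mem_arcSet`). The final turn of the paths
fixes the signs and shows that weights do not drop (`eq_one_of_mem_arcSet`). As generators determine
homomorphisms, automorphisms are exactly the weight-preserving permutations of `V`. A rigidified
Cayley graph of `H` realises `H` this way, and `N` is an isomorphism invariant, so varying it gives
infinitely many classes. -/

/-! ### Partial groups from walks -/

/-- The word `w` can be walked along inside `S`, starting from `s`. -/
def IsWalk {A : Type u} [AddCommGroup A] (S : Set A) : A → List A → Prop
  | s, [] => s ∈ S
  | s, a :: w => s ∈ S ∧ IsWalk S (s + a) w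

namespace IsWalk

variable {A : Type u} [AddCommGroup A] {S : Set A}

theorem start_mem : ∀ {w : List A} {s : A}, IsWalk S s w → s ∈ S
  | [], _, h => h
  | _ :: _, _, h => h.1

theorem append_iff : ∀ {u v : List A} {s : A},
    IsWalk S s (u ++ v) ↔ IsWalk S s u ∧ IsWalk S (s + u.sum) v
  | [], v, s => by
    simpa [IsWalk] using fun h : IsWalk S s v => h.start_mem
  | a :: u, v, s => by
    simp [IsWalk, append_iff (u := u), and_assoc, add_assoc]

theorem end_mem {w : List A} {s : A} (h : IsWalk S s w) : s + w.sum ∈ S := by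
  have h' : IsWalk S s (w ++ []) := by simpa using h
  exact (append_iff.1 h').2

theorem singleton_iff {a s : A} : IsWalk S s [a] ↔ s ∈ S ∧ s + a ∈ S := Iff.rfl

theorem reverse_neg : ∀ {w : List A} {s : A}, IsWalk S s w →
    IsWalk S (s + w.sum) (w.map (-·)).reverse
  | [], s, h => by simpa [IsWalk] using h
  | a :: w, s, h => by
    have hs : (w.map (-·)).sum = -w.sum := (List.sum_neg w).symm
    simp only [List.map_cons, List.reverse_cons, append_iff, singleton_iff, List.sum_reverse, hs,
      List.sum_cons]
    have := reverse_neg h.2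
    refine ⟨by simpa [add_assoc] using this, ?_, ?_⟩
    · simpa [add_assoc] using h.2.start_mem
    · simpa [add_assoc] using h.1

theorem image {B : Type u} [AddCommGroup B] {T : Set B} (f : A →+ B) (hf : ∀ a ∈ S, f a ∈ T) :
    ∀ {w : List A} {s : A}, IsWalk S s w → IsWalk T (f s) (w.map f)
  | [], s, h => hf s h
  | a :: w, s, h => ⟨hf s h.1, by simpa using image f hf h.2⟩

end IsWalk

/-- The differences of two elements of one member of the family `S`. -/
@[ext]
structure WalkStep {A : Type u} [AddCommGroup A] {ι : Type u} (S : ι → Set A) : Type u where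
  val : A
  isWalk : ∃ i s, IsWalk (S i) s [val]

namespace WalkStep

variable {A : Type u} [AddCommGroup A] {ι : Type u} {S : ι → Set A}

/-- The words that can be walked along inside one member of the family `S`. -/
def walks (S : ι → Set A) : Set (List (WalkStep S)) :=
  {w | ∃ i s, IsWalk (S i) s (w.map val)}

/-- The partial group of the words that can be walked along inside one member of `S`. -/
abbrev partialGroup (S : ι → Set A) (hS : ∃ i, (S i).Nonempty) : PartialGroup (WalkStep S) where
  domain := walks S
  prod w := ⟨(w.1.map val).sum, by
    obtain ⟨i, s, h⟩ := w.2
    exact ⟨i, s, h.start_mem, h.end_mem⟩⟩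
  inv a := ⟨-a.1, by
    obtain ⟨i, s, h⟩ := a.2
    exact ⟨i, s + a.1, h.2, by simpa [IsWalk] using h.1⟩⟩
  nil_mem := hS
  singleton_mem a := a.2
  of_append u v := by
    rintro ⟨i, s, h⟩
    rw [List.map_append, IsWalk.append_iff] at h
    exact ⟨⟨i, _, h.1⟩, ⟨i, _, h.2⟩⟩
  prod_singleton a := WalkStep.ext (by simp)
  prod_subword u v w hv := by
    rintro ⟨i, s, h⟩
    refine ⟨⟨i, s, ?_⟩, WalkStep.ext (by simp)⟩
    simp only [List.map_append, IsWalk.append_iff, List.map_cons, List.map_nil, List.sum_append,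
      List.sum_singleton] at h ⊢
    exact ⟨⟨h.1.1, h.1.2.start_mem, h.1.2.end_mem⟩, h.2⟩
  inv_inv a := WalkStep.ext (neg_neg _)
  inv_append u := by
    rintro ⟨i, s, h⟩
    have hn : (u.map fun a : WalkStep S => -a.val).sum = -(u.map val).sum := by
      rw [List.sum_neg, List.map_map]; rfl
    refine ⟨⟨i, s + (u.map val).sum, ?_⟩, WalkStep.ext ?_⟩
    · have h' := h.reverse_neg
      simp only [List.map_append, List.map_reverse, List.map_map, IsWalk.append_iff,
        List.sum_reverse] at h' ⊢
      refine ⟨h', ?_⟩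
      simpa [Function.comp_def, hn] using h
    · simp [Function.comp_def, hn]

end WalkStep

/-! ### Arcs in a free abelian group -/

/-- The path `0, x, 2x, …, (r x y)x, (r x y)x + y` in the free abelian group on `V`. -/
def arcSet {V : Type u} (r : V → V → ℕ) (p : V × V) : Set (V →₀ ℤ) :=
  {a | (∃ i : ℕ, i ≤ r p.1 p.2 ∧ a = Finsupp.single p.1 (i : ℤ)) ∨
    a = Finsupp.single p.1 (r p.1 p.2 : ℤ) + Finsupp.single p.2 1}

/-- A weight function with values from `2` to `N` that takes the value `N` on the diagonal. -/
structure IsWeight {V : Type u} (r : V → V → ℕ) (N : ℕ) : Prop where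
  diag : ∀ x, r x x = N
  two_le : ∀ x y, 2 ≤ r x y
  le : ∀ x y, r x y ≤ N

/-- The elements of the partial group of a weight function. -/
abbrev ArcStep {V : Type u} (r : V → V → ℕ) : Type u := WalkStep (arcSet r)

noncomputable instance {V : Type u} [Nonempty V] (r : V → V → ℕ) : PartialGroup (ArcStep r) :=
  WalkStep.partialGroup _ ⟨Classical.arbitrary _, 0, Or.inl ⟨0, by simp⟩⟩

section Weight

variable {V : Type u} {r : V → V → ℕ} {N : ℕ}

theorem zero_mem_arcSet (p : V × V) : (0 : V →₀ ℤ) ∈ arcSet r p := Or.inl ⟨0, by simp⟩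

theorem apply_of_mem_arcSet_self {x : V} {b : V →₀ ℤ} (hb : b ∈ arcSet r (x, x)) :
    0 ≤ b x ∧ b x ≤ r x x + 1 ∧ ∀ z, z ≠ x → b z = 0 := by
  classical
  rcases hb with ⟨i, hi, rfl⟩ | rfl
  · have hi' : i ≤ r x x := hi
    refine ⟨by simp, by simp; omega, fun z hz => by simp [hz]⟩
  · refine ⟨by simp; omega, by simp, fun z hz => by simp [hz]⟩

theorem apply_of_mem_arcSet {x y : V} (hxy : x ≠ y) {b : V →₀ ℤ} (hb : b ∈ arcSet r (x, y)) :
    0 ≤ b x ∧ b x ≤ r x y ∧ (b y = 0 ∨ b y = 1 ∧ b x = r x y) ∧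
      ∀ z, z ≠ x → z ≠ y → b z = 0 := by
  classical
  rcases hb with ⟨i, hi, rfl⟩ | rfl
  · have hi' : i ≤ r x y := hi
    refine ⟨by simp, by simpa using hi', Or.inl (by simp [Ne.symm hxy]),
      fun z hz _ => by simp [hz]⟩
  · refine ⟨by simp [hxy], by simp [hxy],
      Or.inr ?_, fun z hz hz' => by simp [hz, hz']⟩
    simp [hxy, hxy.symm]

theorem isWalk_replicate {A : Type u} [AddCommGroup A] {S : Set A} {a : A} :
    ∀ {k : ℕ} {s : A}, (∀ i ≤ k, s + i • a ∈ S) → IsWalk S s (List.replicate k a)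
  | 0, s, h => by simpa [IsWalk] using h 0 le_rfl
  | k + 1, s, h => by
    refine ⟨by simpa using h 0 (Nat.zero_le _), isWalk_replicate fun i hi => ?_⟩
    simpa [add_assoc, succ_nsmul'] using h (i + 1) (by omega)

theorem isWalk_arc (x y : V) :
    IsWalk (arcSet r (x, y)) 0
      (List.replicate (r x y) (Finsupp.single x 1) ++ [Finsupp.single y 1]) := by
  rw [IsWalk.append_iff, IsWalk.singleton_iff]
  refine ⟨isWalk_replicate fun i hi => Or.inl ⟨i, hi, by simp⟩, Or.inl ⟨_, le_rfl, ?_⟩, Or.inr ?_⟩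
  · simp
  · simp

/-- Two points of an interval of length `m < K` that are congruent modulo `K` coincide. -/
theorem eq_zero_of_add_mul_le {s t K m : ℤ} (hs : 0 ≤ s) (hs' : s ≤ m) (ht : 0 ≤ s + K * t)
    (ht' : s + K * t ≤ m) (hm : m < K) : t = 0 := by
  by_contra h
  rcases lt_or_gt_of_ne h with h | h <;> nlinarith

/-- Only generators and their inverses can be repeated more than `N` times. -/
theorem eq_zero_or_single_of_mem_arcSet (hr : IsWeight r N) {K : ℕ} (hK : N < K) {p : V × V}
    {s a : V →₀ ℤ} (hs : s ∈ arcSet r p) (hsa : s + K • a ∈ arcSet r p) :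
    a = 0 ∨ K = N + 1 ∧ ∃ v, a = Finsupp.single v 1 ∨ a = Finsupp.single v (-1) := by
  classical
  obtain ⟨x, y⟩ := p
  have h2 := hr.two_le x y
  have hN := hr.le x y
  have hK0 : (K : ℤ) ≠ 0 := by omega
  by_cases hxy : x = y
  · subst hxy
    have hd := hr.diag x
    obtain ⟨a1, a2, a3⟩ := apply_of_mem_arcSet_self hs
    obtain ⟨b1, b2, b3⟩ := apply_of_mem_arcSet_self hsa
    simp only [Finsupp.add_apply, Finsupp.smul_apply, nsmul_eq_mul] at b1 b2 b3
    have hz : ∀ z, z ≠ x → a z = 0 := fun z hz => by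
      have := b3 z hz
      rw [a3 z hz, zero_add] at this
      exact (mul_eq_zero.1 this).resolve_left hK0
    have ha : a = Finsupp.single x (a x) := by
      ext z
      by_cases h : z = x
      · simp [h]
      · simp [h, hz z h]
    by_cases h0 : a x = 0
    · left; rw [ha, h0]; simp
    · right
      -- On the diagonal the last step continues the path, so its length is `N + 1`: only `K = N +
      -- 1` leaves room for a nonzero step.
      have hK1 : ¬ ((r x x : ℤ) + 1 < K) := fun h => h0 (eq_zero_of_add_mul_le a1 a2 b1 b2 h)
      have hK2 : K = N + 1 := by omega
      refine ⟨hK2, x, ?_⟩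
      have u1 : a x ≤ 1 := by
        by_contra h
        nlinarith
      have u2 : -1 ≤ a x := by
        by_contra h
        nlinarith
      have : a x = 1 ∨ a x = -1 := by omega
      exact this.imp (fun h => ha.trans (by rw [h])) (fun h => ha.trans (by rw [h]))
  · left
    obtain ⟨a1, a2, a3, a4⟩ := apply_of_mem_arcSet hxy hs
    obtain ⟨b1, b2, b3, b4⟩ := apply_of_mem_arcSet hxy hsa
    simp only [Finsupp.add_apply, Finsupp.smul_apply, nsmul_eq_mul] at b1 b2 b3 b4
    ext z
    by_cases hzx : z = x
    · subst hzx
      exact eq_zero_of_add_mul_le a1 a2 b1 b2 (by omega)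
    by_cases hzy : z = y
    · subst hzy
      -- The second coordinate only takes the values `0` and `1`.
      have hs₀ : 0 ≤ s z ∧ s z ≤ 1 := by clear b3; omega
      have hs₁ : 0 ≤ s z + K * a z ∧ s z + K * a z ≤ 1 := by clear a3; omega
      exact eq_zero_of_add_mul_le hs₀.1 hs₀.2 hs₁.1 hs₁.2 (by omega)
    · have := b4 z hzx hzy
      rw [a4 z hzx hzy, zero_add] at this
      exact (mul_eq_zero.1 this).resolve_left hK0

/-- A path that goes `k ≥ 2` times along `± u` and then along `± v` detects signs and weight. -/
theorem eq_one_of_mem_arcSet {u v : V} (huv : u ≠ v) {k : ℕ} (hk : 2 ≤ k) {p : V × V} {ε δ : ℤ}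
    (hε : ε = 1 ∨ ε = -1) (hδ : δ = 1 ∨ δ = -1) {s : V →₀ ℤ} (hs : s ∈ arcSet r p)
    (hs₁ : s + k • Finsupp.single u ε ∈ arcSet r p)
    (hs₂ : s + k • Finsupp.single u ε + Finsupp.single v δ ∈ arcSet r p) :
    ε = 1 ∧ δ = 1 ∧ k ≤ r u v := by
  classical
  obtain ⟨x, y⟩ := p
  by_cases hxy : x = y
  · subst hxy
    obtain ⟨a1, a2, a3⟩ := apply_of_mem_arcSet_self hs
    obtain ⟨b1, b2, b3⟩ := apply_of_mem_arcSet_self hs₁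
    obtain ⟨c1, c2, c3⟩ := apply_of_mem_arcSet_self hs₂
    simp only [Finsupp.add_apply, Finsupp.smul_apply, nsmul_eq_mul, Finsupp.single_apply] at b3 c3
    -- A diagonal arc moves in one coordinate only, but both `u` and `v` are used.
    exfalso
    by_cases hux : u = x
    · subst hux
      have h1 := b3 v huv.symm
      have h2 := c3 v huv.symm
      simp [huv] at h1 h2
      omega
    · have h1 := a3 u hux
      have h2 := b3 u hux
      rcases hε with rfl | rfl <;> simp [h1] at h2 <;> omega
  · obtain ⟨a1, a2, a3, a4⟩ := apply_of_mem_arcSet hxy hs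
    obtain ⟨b1, b2, b3, b4⟩ := apply_of_mem_arcSet hxy hs₁
    obtain ⟨c1, c2, c3, c4⟩ := apply_of_mem_arcSet hxy hs₂
    simp only [Finsupp.add_apply, Finsupp.smul_apply, nsmul_eq_mul, Finsupp.single_apply]
      at b1 b2 b3 b4 c1 c2 c3 c4
    -- The `y`-coordinate cannot change by `k ≥ 2`, which is why weights are at least `2`.
    by_cases huy : u = y
    · subst huy
      exfalso
      rcases hε with rfl | rfl <;> simp at b3 <;> omega
    have hux : u = x := by
      by_contra hux
      have h1 := a4 u hux huy
      have h2 := b4 u hux huy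
      rcases hε with rfl | rfl <;> simp [h1] at h2 <;> omega
    subst hux
    have hvy : v = y := by
      by_contra hvy
      have h1 := b4 v huv.symm hvy
      have h2 := c4 v huv.symm hvy
      rw [h1] at h2
      simp at h2
      omega
    subst hvy
    simp [huv, huv.symm] at b1 b2 b3 c1 c2 c3
    -- The `y`-coordinate is nonzero only at the endpoint of the arc. With `δ = -1` the `k` steps
    -- would have to stay there; so `δ = 1`, and they end at `x`-coordinate `r x y`.
    rcases hε with rfl | rfl <;> rcases hδ with rfl | rfl <;> refine ⟨?_, ?_, ?_⟩ <;> omega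

/-- The generator of `ArcStep r` that belongs to an element of `V`. -/
noncomputable def ArcStep.of (r : V → V → ℕ) (x : V) : ArcStep r :=
  ⟨Finsupp.single x 1, (x, x), Finsupp.single x (r x x), Or.inl ⟨_, le_rfl, rfl⟩, Or.inr rfl⟩

theorem ArcStep.of_injective : Function.Injective (ArcStep.of r) := fun _ _ h =>
  Finsupp.single_left_injective one_ne_zero (congrArg WalkStep.val h)

theorem arc_mem_walks (x y : V) :
    List.replicate (r x y) (ArcStep.of r x) ++ [ArcStep.of r y] ∈ WalkStep.walks (arcSet r) :=
  ⟨(x, y), 0, by simpa [ArcStep.of] using isWalk_arc x y⟩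

/-- The zero step of `ArcStep r`. -/
def ArcStep.zero (r : V → V → ℕ) (p : V × V) : ArcStep r :=
  ⟨0, p, 0, zero_mem_arcSet p, by simpa [IsWalk] using zero_mem_arcSet p⟩

end Weight

/-! ### Injective homomorphisms and generators -/

section Hom

variable {V V' : Type u} [Nonempty V] [Nonempty V'] {r : V → V → ℕ} {r' : V' → V' → ℕ} {N : ℕ}

theorem PartialGroupHom.val_eq_sum (f : PartialGroupHom (ArcStep r) (ArcStep r'))
    {w : List (ArcStep r)} (hw : w ∈ WalkStep.walks (arcSet r)) {a : ArcStep r}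
    (ha : (w.map WalkStep.val).sum = a.val) :
    ((w.map f.toFun).map WalkStep.val).sum = (f.toFun a).val := by
  have h := f.map_prod w hw
  have ha' : PartialGroup.prod ⟨w, hw⟩ = a := WalkStep.ext ha
  rw [ha'] at h
  exact congrArg WalkStep.val h

theorem PartialGroupHom.val_ne_zero (f : PartialGroupHom (ArcStep r) (ArcStep r'))
    (hf : Function.Injective f.toFun) {a : ArcStep r} (ha : a.val ≠ 0) : (f.toFun a).val ≠ 0 := by
  intro h
  have h0 : (f.toFun (.zero r (Classical.arbitrary _))).val = 0 :=
    (f.val_eq_sum (w := []) PartialGroup.nil_mem rfl).symm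
  exact ha (congrArg WalkStep.val (hf (WalkStep.ext (h.trans h0.symm))))

theorem PartialGroupHom.exists_isWalk (f : PartialGroupHom (ArcStep r) (ArcStep r')) (x y : V) :
    ∃ p s, s ∈ arcSet r' p ∧ s + r x y • (f.toFun (.of r x)).val ∈ arcSet r' p ∧
      s + r x y • (f.toFun (.of r x)).val + (f.toFun (.of r y)).val ∈ arcSet r' p := by
  obtain ⟨p, s, h⟩ := f.map_domain _ (arc_mem_walks x y)
  simp only [List.map_append, List.map_replicate, List.map_cons, List.map_nil, IsWalk.append_iff,
    IsWalk.singleton_iff, List.sum_replicate] at h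
  exact ⟨p, s, h.1.start_mem, h.2⟩

theorem PartialGroupHom.exists_pow_mem (f : PartialGroupHom (ArcStep r) (ArcStep r'))
    (hr : IsWeight r N) (x : V) :
    ∃ p s, s ∈ arcSet r' p ∧ s + (N + 1) • (f.toFun (.of r x)).val ∈ arcSet r' p := by
  obtain ⟨p, s, h, _, h'⟩ := f.exists_isWalk x x
  rw [hr.diag, add_assoc, ← succ_nsmul] at h'
  exact ⟨p, s, h, h'⟩

theorem PartialGroupHom.weight_le (f : PartialGroupHom (ArcStep r) (ArcStep r'))
    (hf : Function.Injective f.toFun) {N' : ℕ} (hr : IsWeight r N) (hr' : IsWeight r' N') :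
    N ≤ N' := by
  by_contra! hN
  obtain ⟨p, s, h, h'⟩ := f.exists_pow_mem hr (Classical.arbitrary V)
  rcases eq_zero_or_single_of_mem_arcSet hr' (by omega) h h' with h | h
  · exact f.val_ne_zero hf (by simp [ArcStep.of]) h
  · omega

/-- An injective homomorphism maps generators to generators and does not decrease weights. -/
theorem PartialGroupHom.exists_map_of [Nontrivial V]
    (f : PartialGroupHom (ArcStep r) (ArcStep r'))
    (hf : Function.Injective f.toFun) (hr : IsWeight r N) (hr' : IsWeight r' N) :
    ∃ σ : V → V', (∀ x, f.toFun (.of r x) = .of r' (σ x)) ∧ ∀ x y, r x y ≤ r' (σ x) (σ y) := by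
  have h1 : ∀ x, ∃ v, ∃ ε : ℤ, (ε = 1 ∨ ε = -1) ∧
      (f.toFun (.of r x)).val = Finsupp.single v ε := fun x => by
    obtain ⟨p, s, h, h'⟩ := f.exists_pow_mem hr x
    rcases eq_zero_or_single_of_mem_arcSet hr' (by omega) h h' with h | ⟨-, v, h | h⟩
    · exact absurd h (f.val_ne_zero hf (by simp [ArcStep.of]))
    · exact ⟨v, 1, .inl rfl, h⟩
    · exact ⟨v, -1, .inr rfl, h⟩
  choose σ ε hε hσ using h1
  have hinj : ∀ x y, x ≠ y → σ x ≠ σ y := by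
    intro x y hxy h
    by_cases he : ε x = ε y
    · refine hxy (ArcStep.of_injective (hf (WalkStep.ext ?_)))
      rw [hσ, hσ, h, he]
    · have hsum : ε x + ε y = 0 := by
        rcases hε x with h | h <;> rcases hε y with h' | h' <;> omega
      -- With opposite signs, the inverse of `x` and the generator `y` have the same image.
      let n : ArcStep r := PartialGroup.inv (.of r x)
      have hn : (f.toFun n).val = (f.toFun (.of r y)).val := by
        obtain ⟨hw, -⟩ := PartialGroup.inv_append [ArcStep.of r x] (PartialGroup.singleton_mem _)
        have hs := f.val_eq_sum hw (a := .zero r (x, x))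
          (by simp [PartialGroup.inv, ArcStep.zero])
        have hz := f.val_eq_sum (w := []) PartialGroup.nil_mem (a := .zero r (x, x)) rfl
        rw [← hz] at hs
        simp [hσ, h] at hs
        rw [eq_neg_of_add_eq_zero_left hs, hσ, ← Finsupp.single_neg, eq_neg_of_add_eq_zero_left hsum,
          neg_neg]
      have := congrArg WalkStep.val (hf (WalkStep.ext hn))
      have := DFunLike.congr_fun this y
      classical
      simp [n, PartialGroup.inv, ArcStep.of, hxy] at this
  have key : ∀ x y, x ≠ y → ε x = 1 ∧ ε y = 1 ∧ r x y ≤ r' (σ x) (σ y) := by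
    intro x y hxy
    obtain ⟨p, s, h₀, h₁, h₂⟩ := f.exists_isWalk x y
    rw [hσ] at h₁ h₂
    rw [hσ] at h₂
    exact eq_one_of_mem_arcSet (hinj x y hxy) (hr.two_le x y) (hε x) (hε y) h₀ h₁ h₂
  refine ⟨σ, fun x => WalkStep.ext ?_, fun x y => ?_⟩
  · obtain ⟨y, hy⟩ := exists_ne x
    rw [hσ, (key x y hy.symm).1]
    rfl
  · by_cases hxy : x = y
    · rw [hxy, hr.diag, hr'.diag]
    · exact (key x y hxy).2.2

/-- Homomorphisms are determined by their values on the generators. -/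
theorem PartialGroupHom.ext_of {f g : PartialGroupHom (ArcStep r) (ArcStep r')}
    (h : ∀ x, f.toFun (.of r x) = g.toFun (.of r x)) : f = g := by
  have hpt : ∀ (p : V × V) (a : ArcStep r), a.val ∈ arcSet r p →
      (f.toFun a).val = (g.toFun a).val := by
    rintro ⟨x, y⟩ a (⟨i, hi, ha⟩ | ha)
    · have hw : List.replicate i (ArcStep.of r x) ∈ WalkStep.walks (arcSet r) := by
        obtain ⟨j, hj⟩ := Nat.exists_eq_add_of_le hi
        have hw := (PartialGroup.of_append _ _ (arc_mem_walks (r := r) x y)).1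
        simp only at hj
        rw [hj, List.replicate_add] at hw
        exact (PartialGroup.of_append _ _ hw).1
      have ha' : ((List.replicate i (ArcStep.of r x)).map WalkStep.val).sum = a.val := by
        simp [ha, ArcStep.of]
      rw [← f.val_eq_sum hw ha', ← g.val_eq_sum hw ha']
      simp [h]
    · have ha' : ((List.replicate (r x y) (ArcStep.of r x) ++ [ArcStep.of r y]).map
          WalkStep.val).sum = a.val := by
        simp [ha, ArcStep.of]
      rw [← f.val_eq_sum (arc_mem_walks x y) ha', ← g.val_eq_sum (arc_mem_walks x y) ha']
      simp [h]
  refine PartialGroupHom.ext (funext fun a => WalkStep.ext ?_)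
  obtain ⟨p, s, hs, hsa⟩ := a.isWalk
  -- Each step `a` is a difference of arc points `c` and `b`; the relation `b + a = c` is preserved,
  -- and `b` can be cancelled.
  let b : ArcStep r := ⟨s, p, 0, zero_mem_arcSet _, by simpa [IsWalk] using hs⟩
  let c : ArcStep r := ⟨s + a.val, p, 0, zero_mem_arcSet _, by simpa [IsWalk] using hsa⟩
  have hw : [b, a] ∈ WalkStep.walks (arcSet r) :=
    ⟨p, 0, zero_mem_arcSet _, by simpa [IsWalk, b] using ⟨hs, hsa⟩⟩
  have hf := f.val_eq_sum hw (a := c) (by simp [b, c])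
  have hg := g.val_eq_sum hw (a := c) (by simp [b, c])
  rw [← hpt p c hsa] at hg
  simpa [hpt p b hs] using hf.trans hg.symm

/-- The homomorphism induced by a weight-preserving map. -/
noncomputable def ArcStep.map (σ : V → V') (hσ : ∀ x y, r' (σ x) (σ y) = r x y) :
    PartialGroupHom (ArcStep r) (ArcStep r') :=
  have hS : ∀ p, ∀ a ∈ arcSet r p, Finsupp.mapDomain.addMonoidHom σ a ∈
      arcSet r' (σ p.1, σ p.2) := by
    rintro ⟨x, y⟩ _ (⟨i, hi, rfl⟩ | rfl)
    · exact Or.inl ⟨i, by simpa [hσ] using hi, by simp [Finsupp.mapDomain_single]⟩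
    · exact Or.inr (by simp [Finsupp.mapDomain_add, Finsupp.mapDomain_single, hσ])
  { toFun := fun a => ⟨Finsupp.mapDomain.addMonoidHom σ a.val, by
      obtain ⟨p, s, h⟩ := a.isWalk
      exact ⟨_, _, h.image _ (hS p)⟩⟩
    map_domain := by
      rintro w ⟨p, s, h⟩
      have h' := h.image _ (hS p)
      rw [List.map_map] at h'
      refine ⟨(σ p.1, σ p.2), Finsupp.mapDomain.addMonoidHom σ s, ?_⟩
      rw [List.map_map]
      exact h'
    map_prod := fun w hw => WalkStep.ext (by
      refine Eq.trans (congrArg List.sum ?_)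
        (map_list_sum (Finsupp.mapDomain.addMonoidHom σ) (w.map WalkStep.val)).symm
      rw [List.map_map, List.map_map]
      rfl) }

theorem ArcStep.map_of (σ : V → V') (hσ : ∀ x y, r' (σ x) (σ y) = r x y) (x : V) :
    (ArcStep.map σ hσ).toFun (.of r x) = .of r' (σ x) :=
  WalkStep.ext Finsupp.mapDomain_single

end Hom

/-- The partial group of a weight function, as an object of the category. -/
noncomputable abbrev ArcGrp {V : Type u} [Nonempty V] (r : V → V → ℕ) : PartGrp.{u} := ⟨ArcStep r⟩

/-! ### Automorphisms as weight-preserving permutations -/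

section Iso

theorem PartGrp.hom_injective {M N : PartGrp.{u}} (f : M ≅ N) :
    Function.Injective (PartialGroupHom.toFun f.hom) := fun a b h => by
  have e : ∀ c, f.inv.toFun (f.hom.toFun c) = c := fun c =>
    congrArg (fun g : PartialGroupHom M.carrier M.carrier => g.toFun c) f.hom_inv_id
  rw [← e a, h, e]

variable {V : Type u} [Nontrivial V] {r : V → V → ℕ} {N : ℕ}

theorem PartGrp.exists_perm (hr : IsWeight r N) (f : Aut (ArcGrp r)) :
    ∃ σ : Equiv.Perm V, (∀ x y, r (σ x) (σ y) = r x y) ∧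
      ∀ x, PartialGroupHom.toFun f.hom (.of r x) = .of r (σ x) := by
  obtain ⟨σ, h, hσ⟩ := PartialGroupHom.exists_map_of f.hom (PartGrp.hom_injective f) hr hr
  obtain ⟨τ, h', hτ⟩ := PartialGroupHom.exists_map_of f.inv (PartGrp.hom_injective f.symm) hr hr
  have e : ∀ c, f.inv.toFun (f.hom.toFun c) = c := fun c =>
    congrArg (fun g : PartialGroupHom (ArcStep r) (ArcStep r) => g.toFun c) f.hom_inv_id
  have e' : ∀ c, f.hom.toFun (f.inv.toFun c) = c := fun c =>
    congrArg (fun g : PartialGroupHom (ArcStep r) (ArcStep r) => g.toFun c) f.inv_hom_id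
  have hl : Function.LeftInverse τ σ := fun x => ArcStep.of_injective (r := r) (by
    rw [← h', ← h, e])
  have hrt : Function.RightInverse τ σ := fun x => ArcStep.of_injective (r := r) (by
    rw [← h, ← h', e'])
  -- Weights do not drop under `σ` or its inverse, hence are equal.
  refine ⟨⟨σ, τ, hl, hrt⟩, fun x y => le_antisymm ?_ (hσ x y), h⟩
  simpa [hl x, hl y] using hτ (σ x) (σ y)

/-- A group acting by weight-preserving permutations acts on the partial group. -/
noncomputable def ArcGrp.toAut {H : Type u} [Group H] (ρ : H →* Equiv.Perm V)
    (hρ : ∀ h x y, r (ρ h x) (ρ h y) = r x y) : H →* Aut (ArcGrp r) where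
  toFun h :=
    { hom := ArcStep.map (ρ h) (hρ h)
      inv := ArcStep.map (ρ h⁻¹) (hρ h⁻¹)
      hom_inv_id := PartialGroupHom.ext_of fun x => by
        change (ArcStep.map (ρ h⁻¹) (hρ h⁻¹)).toFun ((ArcStep.map (ρ h) (hρ h)).toFun (.of r x)) =
          .of r x
        rw [ArcStep.map_of, ArcStep.map_of, map_inv]
        exact congrArg _ ((ρ h).symm_apply_apply x)
      inv_hom_id := PartialGroupHom.ext_of fun x => by
        change (ArcStep.map (ρ h) (hρ h)).toFun ((ArcStep.map (ρ h⁻¹) (hρ h⁻¹)).toFun (.of r x)) =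
          .of r x
        rw [ArcStep.map_of, ArcStep.map_of, map_inv]
        exact congrArg _ ((ρ h).apply_symm_apply x) }
  map_one' := Iso.ext <| PartialGroupHom.ext_of fun x => by
    change (ArcStep.map (ρ 1) (hρ 1)).toFun (.of r x) = .of r x
    rw [ArcStep.map_of, map_one, Equiv.Perm.one_apply]
  map_mul' g h := Iso.ext <| PartialGroupHom.ext_of fun x => by
    change (ArcStep.map (ρ (g * h)) (hρ (g * h))).toFun (.of r x) =
      (ArcStep.map (ρ g) (hρ g)).toFun ((ArcStep.map (ρ h) (hρ h)).toFun (.of r x))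
    rw [ArcStep.map_of, ArcStep.map_of, ArcStep.map_of, map_mul, Equiv.Perm.mul_apply]

theorem ArcGrp.toAut_of {H : Type u} [Group H] (ρ : H →* Equiv.Perm V)
    (hρ : ∀ h x y, r (ρ h x) (ρ h y) = r x y) (h : H) (x : V) :
    PartialGroupHom.toFun (ArcGrp.toAut ρ hρ h).hom (.of r x) = .of r (ρ h x) :=
  ArcStep.map_of (ρ h) (hρ h) x

theorem ArcGrp.nonempty_mulEquiv {H : Type u} [Group H] (hr : IsWeight r N)
    (ρ : H →* Equiv.Perm V) (hinj : Function.Injective ρ)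
    (hρ : ∀ h x y, r (ρ h x) (ρ h y) = r x y)
    (hσ : ∀ σ : Equiv.Perm V, (∀ x y, r (σ x) (σ y) = r x y) → ∃ h, ∀ x, σ x = ρ h x) :
    Nonempty (Aut (ArcGrp r) ≃* H) := by
  refine ⟨(MulEquiv.ofBijective (ArcGrp.toAut ρ hρ) ⟨fun g h hgh => ?_, fun f => ?_⟩).symm⟩
  · refine hinj (Equiv.ext fun x => ArcStep.of_injective (r := r) ?_)
    rw [← ArcGrp.toAut_of ρ hρ, ← ArcGrp.toAut_of ρ hρ, hgh]
  · obtain ⟨σ, h₁, h₂⟩ := PartGrp.exists_perm hr f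
    obtain ⟨h, hh⟩ := hσ σ h₁
    refine ⟨h, Iso.ext <| PartialGroupHom.ext_of fun x => ?_⟩
    exact (ArcGrp.toAut_of ρ hρ h x).trans (by rw [← hh]; exact (h₂ x).symm)

end Iso

/-! ### A rigid weight for a given group -/

section Cayley

variable (H : Type u) [Group H]

open Classical in
/-- A weight function on `H × Option H` whose weight-preserving permutations are the left
translations by elements of `H`. -/
noncomputable def cayleyWeight (N : ℕ) (x y : H × Option H) : ℕ :=
  if x = y then N
  -- Value `3` well-orders each fibre over `H`, and `4` encodes Cayley edges, labelled by the second
  -- coordinate of the source. The point `none` gives two vertices even for trivial `H`.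
  else if x.1 = y.1 then if WellOrderingRel x.2 y.2 then 3 else 2
  else if x.2 = some (x.1⁻¹ * y.1) then 4 else 2

variable {H} {N : ℕ}

theorem isWeight_cayleyWeight (hN : 5 ≤ N) : IsWeight (cayleyWeight H N) N where
  diag x := by simp [cayleyWeight]
  two_le x y := by unfold cayleyWeight; split_ifs <;> omega
  le x y := by unfold cayleyWeight; split_ifs <;> omega

variable (H) in
/-- Left translation on the first factor of `H × Option H`. -/
def leftTranslation : H →* Equiv.Perm (H × Option H) where
  toFun h := (Equiv.mulLeft h).prodCongr (Equiv.refl _)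
  map_one' := by ext x <;> simp
  map_mul' g h := by ext x <;> simp [mul_assoc]

theorem leftTranslation_apply (h : H) (x : H × Option H) :
    leftTranslation H h x = (h * x.1, x.2) := rfl

theorem leftTranslation_injective : Function.Injective (leftTranslation H) := fun g h hgh => by
  simpa [leftTranslation_apply] using congrArg (fun σ => (σ (1, none)).1) hgh

theorem cayleyWeight_leftTranslation (h : H) (x y : H × Option H) :
    cayleyWeight H N (leftTranslation H h x) (leftTranslation H h y) = cayleyWeight H N x y := by
  classical
  unfold cayleyWeight
  refine if_congr (by simp) rfl (if_congr ?_ rfl (if_congr ?_ rfl rfl)) <;>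
    simp [leftTranslation_apply, mul_assoc]

theorem cayleyWeight_eq_three (hN : 5 ≤ N) {x y : H × Option H} :
    cayleyWeight H N x y = 3 ↔ x.1 = y.1 ∧ WellOrderingRel x.2 y.2 := by
  unfold cayleyWeight
  split_ifs with h h1 h2 h3
  · subst h
    simpa [irrefl] using by omega
  all_goals simp_all

theorem cayleyWeight_eq_four (hN : 5 ≤ N) {x y : H × Option H} :
    cayleyWeight H N x y = 4 ↔ x.1 ≠ y.1 ∧ x.2 = some (x.1⁻¹ * y.1) := by
  unfold cayleyWeight
  split_ifs with h h1 h2 h3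
  · subst h
    simpa using by omega
  all_goals simp_all

theorem exists_eq_leftTranslation (hN : 5 ≤ N) (σ : Equiv.Perm (H × Option H))
    (hσ : ∀ x y, cayleyWeight H N (σ x) (σ y) = cayleyWeight H N x y) :
    ∃ h, ∀ x, σ x = leftTranslation H h x := by
  have h3 : ∀ x y, ((σ x).1 = (σ y).1 ∧ WellOrderingRel (σ x).2 (σ y).2) ↔
      x.1 = y.1 ∧ WellOrderingRel x.2 y.2 := fun x y => by
    rw [← cayleyWeight_eq_three hN, hσ, cayleyWeight_eq_three hN]
  have fib : ∀ (σ : Equiv.Perm (H × Option H)), (∀ x y, ((σ x).1 = (σ y).1 ∧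
      WellOrderingRel (σ x).2 (σ y).2) ↔ x.1 = y.1 ∧ WellOrderingRel x.2 y.2) →
      ∀ x y, x.1 = y.1 → (σ x).1 = (σ y).1 := fun σ h3 x y hxy => by
    rcases trichotomous_of WellOrderingRel x.2 y.2 with h | h | h
    · exact ((h3 x y).2 ⟨hxy, h⟩).1
    · rw [Prod.ext hxy h]
    · exact ((h3 y x).2 ⟨hxy.symm, h⟩).1.symm
  have fib_symm := fib σ.symm fun x y => by
    simpa using (h3 (σ.symm x) (σ.symm y)).symm
  have hsnd : ∀ x, (σ x).2 = x.2 := by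
    intro x
    have hfst : ∀ c, (σ (x.1, c)).1 = (σ x).1 := fun c => fib σ h3 _ _ rfl
    have hfst' : ∀ c, (σ.symm ((σ x).1, c)).1 = x.1 := fun c => by
      simpa using fib_symm ((σ x).1, c) (σ x) rfl
    let e : Option H ≃ Option H :=
      { toFun := fun c => (σ (x.1, c)).2
        invFun := fun c => (σ.symm ((σ x).1, c)).2
        left_inv := fun c => by
          have : ((σ x).1, (σ (x.1, c)).2) = σ (x.1, c) := Prod.ext (hfst c).symm rfl
          simp only [this, Equiv.symm_apply_apply]
        right_inv := fun c => by
          have : (x.1, (σ.symm ((σ x).1, c)).2) = σ.symm ((σ x).1, c) :=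
            Prod.ext (hfst' c).symm rfl
          simp only [this, Equiv.apply_symm_apply] }
    let e' : (WellOrderingRel : Option H → Option H → Prop) ≃r
        (WellOrderingRel : Option H → Option H → Prop) :=
      ⟨e, fun {c d} => by
        have := h3 (x.1, c) (x.1, d)
        simp only [hfst, true_and] at this
        exact this⟩
    -- A well-order has no automorphism but the identity.
    have : e' = RelIso.refl _ := RelIso.ext fun c =>
      InitialSeg.eq e'.toInitialSeg (RelIso.refl _).toInitialSeg c
    exact congrArg (fun k : (WellOrderingRel : Option H → Option H → Prop) ≃r
      (WellOrderingRel : Option H → Option H → Prop) => k x.2) this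
  refine ⟨(σ (1, none)).1, fun x => Prod.ext ?_ (hsnd x)⟩
  change (σ x).1 = (σ (1, none)).1 * x.1
  by_cases hx : x.1 = 1
  · rw [hx, mul_one]
    exact fib σ h3 _ _ hx
  -- The Cayley edge labelled `x.1` from the fibre over `1` must go to the edge with the same label
  -- from the image fibre.
  · have h4 : cayleyWeight H N (1, some x.1) x = 4 :=
      (cayleyWeight_eq_four hN).2 ⟨Ne.symm hx, by simp⟩
    rw [← hσ, cayleyWeight_eq_four hN, hsnd] at h4
    have := Option.some.inj h4.2
    rw [this, fib σ h3 (1, none) (1, some x.1) rfl, mul_inv_cancel_left]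

end Cayley

theorem theoremA :
    IsUniversalCategory PartGrp.{u} ∧
      ∀ (H : Type u) [Group H], ∃ M : ℕ → PartGrp.{u},
        (∀ n, Nonempty (Aut (M n) ≃* H)) ∧
          ∀ m n, m ≠ n → IsEmpty (M m ≅ M n) := by
  have key : ∀ (H : Type u) [Group H] (n : ℕ),
      Nonempty (Aut (ArcGrp (cayleyWeight H (n + 5))) ≃* H) := fun H _ n =>
    ArcGrp.nonempty_mulEquiv (isWeight_cayleyWeight (by omega)) (leftTranslation H)
      leftTranslation_injective cayleyWeight_leftTranslation (exists_eq_leftTranslation (N := n + 5) (by omega))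
  refine ⟨fun H _ => ⟨_, key H 0⟩, fun H _ => ⟨_, key H, fun m n hmn => ⟨fun f => hmn ?_⟩⟩⟩
  have hw : ∀ n, IsWeight (cayleyWeight H (n + 5)) (n + 5) := fun n =>
    isWeight_cayleyWeight (by omega)
  have h₁ := PartialGroupHom.weight_le f.hom (PartGrp.hom_injective f) (hw m) (hw n)
  have h₂ := PartialGroupHom.weight_le f.inv (PartGrp.hom_injective f.symm) (hw n) (hw m)
  omega
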